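/- For positive integers $s_1,\dots,s_r$ and signs $\varepsilon_1,\dots,\varepsilon_r\in\{1,-1\}$ put $$\zeta(s_1,\dots,s_r;\varepsilon_1,\dots,\varepsilon_r)=\sum_{k_1>\cdots>k_r\ge 1}\frac{\varepsilon_1^{k_1}\cdots\varepsilon_r^{k_r}}{k_1^{s_1}\cdots k_r^{s_r}},\qquad \zeta^\star(s_1,\dots,s_r;\varepsilon_1,\dots,\varepsilon_r)=\sum_{k_1\ge\cdots\ge k_r\ge 1}\frac{\varepsilon_1^{k_1}\cdots\varepsilon_r^{k_r}}{k_1^{s_1}\cdots k_r^{s_r}}$$ whenever the series converges absolutely; both are $1$ for the empty index ($r=0$). An argument $s_j$ with $\varepsilon_j=1$ is written $s_j$, one with $\varepsilon_j=-1$ is written $\overline{s}_j$ (and the list of signs is then omitted), and $\{a_1,\dots,a_l\}^d$ denotes $d$ successive repetitions of the sequence $a_1,\dots,a_l$. Then all the series below converge absolutely, and for every integer $d\ge 0$, $$\zeta^\star(\{3,1\}^d)=\sum_{k=0}^{2d}\zeta(\{\overline{2}\}^k)\,\zeta^\star(\{\overline{2}\}^{2d-k}),$$ $$\zeta^\star(\{3,1\}^d,2)=-\sum_{k=0}^{2d+1}\zeta(\{\overline{2}\}^k)\,\zeta^\star(\{\overline{2}\}^{2d+1-k}).$$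 -/

import Mathlib

namespace EulerSum

/-- A multi-index `(s₁, …, s_r)` together with signs `(ε₁, …, ε_r)`, `ε_j ∈ {1, -1}`,
as the list of the pairs `(s_j, ε_j)`. -/
abbrev SignedIndex : Type := List (ℕ × ℤˣ)

/-- The unsigned argument `s`, that is, `s` with sign `1`. -/
def plain (s : ℕ) : ℕ × ℤˣ := (s, 1)

/-- The argument `s̄`, that is, `s` with sign `-1`. -/
def bar (s : ℕ) : ℕ × ℤˣ := (s, -1)

/-- `{a₁, …, a_l}^d`: the block `b = (a₁, …, a_l)` repeated `d` times. -/
def rep (b : SignedIndex) (d : ℕ) : SignedIndex := (List.replicate d b).flatten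

/-- The summand `ε₁^{k₁} ⋯ ε_r^{k_r} / (k₁^{s₁} ⋯ k_r^{s_r})`. -/
noncomputable def term (s : SignedIndex) (k : Fin s.length → ℕ+) : ℝ :=
  ∏ j : Fin s.length, (((s.get j).2 : ℤ) : ℝ) ^ (k j : ℕ) / ((k j : ℕ) : ℝ) ^ (s.get j).1

/-- The series over `k₁ > ⋯ > k_r ≥ 1` converges (unconditionally). -/
def ZetaSummable (s : SignedIndex) : Prop :=
  Summable fun k : {k : Fin s.length → ℕ+ // StrictAnti k} => term s k.1

/-- The series over `k₁ ≥ ⋯ ≥ k_r ≥ 1` converges (unconditionally). -/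
def ZetaStarSummable (s : SignedIndex) : Prop :=
  Summable fun k : {k : Fin s.length → ℕ+ // Antitone k} => term s k.1

/-- The (alternating) multiple zeta value: the sum over `k₁ > ⋯ > k_r ≥ 1`. It is `1` for the
empty index. -/
noncomputable def zeta (s : SignedIndex) : ℝ :=
  ∑' k : {k : Fin s.length → ℕ+ // StrictAnti k}, term s k.1

/-- The (alternating) multiple zeta star value: the sum over `k₁ ≥ ⋯ ≥ k_r ≥ 1`. It is `1` for the
empty index. -/
noncomputable def zetaStar (s : SignedIndex) : ℝ :=
  ∑' k : {k : Fin s.length → ℕ+ // Antitone k}, term s k.1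

end EulerSum

/-!
Put `t_j = (-1)^j z / j²`. The sums of products on the right are the coefficients `c_m` of `z ^ m`
in `∏ (1 + t_j) / (1 - t_j)`, the limit of the coefficients `c_m(n)` of the product over `j ≤ n`,
which satisfy
`c_{m+1}(k) - c_{m+1}(k-1) = (-1)^k / k² * (c_m(k) + c_m(k-1))`.
Average `c_m` against the kernel `n!² / ((n-k)! (n+k)!)`, which tends to `1` as `n → ∞`: the sum
`∑ k ≤ n, n!² / ((n-k)! (n+k)!) * (c_m(k) - c_m(k-1))`, where `c_m(-1) = 0`, has the same limit
`c_m`. Telescoping identities for the kernel show that these averages for `m + 2` arise from those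
for `m` by the operation `f ↦ ∑ a ≤ n, a⁻³ ∑ b ≤ a, b⁻¹ f(b)`, which prepends `3, 1` to the index
of a truncated star sum; they are thus, up to sign, the truncated star sums of `({3, 1}^d)` and
`({3, 1}^d, 2)`.
-/

namespace EulerSum

open Filter Finset Topology

section Gaps

/-- Index tuples `(k₁, …, k_r)` with `k_i ≥ k_j + e` for `i < j`: the antitone ones for `e = 0`,
the strictly antitone ones for `e = 1`. This treats both kinds of series at once. -/
def HasGaps (e : ℕ) {r : ℕ} (k : Fin r → ℕ+) : Prop :=
  ∀ ⦃i j⦄, i < j → (k j : ℕ) + e ≤ k i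

theorem antitone_eq_hasGaps_zero (r : ℕ) :
    (Antitone : (Fin r → ℕ+) → Prop) = HasGaps 0 :=
  funext fun _ => propext antitone_iff_forall_lt

theorem hasGaps_cons {e r : ℕ} {a : ℕ+} {k : Fin r → ℕ+} :
    HasGaps e (Fin.cons a k : Fin (r + 1) → ℕ+) ↔
      (∀ i, (k i : ℕ) + e ≤ a) ∧ HasGaps e k := by
  simp [HasGaps, Fin.forall_fin_succ]

/-- The tuples with gaps at least `e` all of whose entries are at most `n`, enumerated by their
first entry. -/
def gapTuples (e : ℕ) : (r : ℕ) → ℕ → Finset (Fin r → ℕ+)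
  | 0, _ => {Fin.elim0}
  | r + 1, n => ((range n).sigma fun j => gapTuples e r (j + 1 - e)).map
      ⟨fun x => Fin.cons x.1.succPNat x.2, by
        rintro ⟨i, k⟩ ⟨j, l⟩ h
        obtain ⟨hij, hkl⟩ := Fin.cons_inj.1 h
        exact Sigma.ext (Nat.succPNat_injective hij) (heq_of_eq hkl)⟩

theorem cons_mem_gapTuples {e r n : ℕ} {a : ℕ+} {k : Fin r → ℕ+} :
    (Fin.cons a k : Fin (r + 1) → ℕ+) ∈ gapTuples e (r + 1) n ↔
      (a : ℕ) ≤ n ∧ k ∈ gapTuples e r (a - e) := by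
  rw [gapTuples, Finset.mem_map]
  constructor
  · rintro ⟨⟨j, l⟩, hjl, h⟩
    obtain ⟨rfl, rfl⟩ := (Fin.cons_inj (α := fun _ => ℕ+)).1 h
    rw [mem_sigma, mem_range] at hjl
    exact hjl
  · rintro ⟨ha, hk⟩
    have hpred := a.natPred_add_one
    refine ⟨⟨a.natPred, k⟩, mem_sigma.2 ⟨mem_range.2 ?_, ?_⟩, ?_⟩
    · exact Nat.lt_of_succ_le (hpred.trans_le ha)
    · rwa [hpred]
    · exact (Fin.cons_inj (α := fun _ => ℕ+)).2 ⟨a.succPNat_natPred, rfl⟩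

theorem mem_gapTuples {e r n : ℕ} {k : Fin r → ℕ+} :
    k ∈ gapTuples e r n ↔ (∀ i, (k i : ℕ) ≤ n) ∧ HasGaps e k := by
  induction r generalizing n with
  | zero => simp [gapTuples, HasGaps, Subsingleton.elim k Fin.elim0]
  | succ r ih =>
    induction k using Fin.consCases with
    | _ a k =>
      have hle : ∀ i, (k i : ℕ) ≤ a - e ↔ (k i : ℕ) + e ≤ a := fun i => by
        have := (k i).pos
        omega
      rw [cons_mem_gapTuples, ih, hasGaps_cons, Fin.forall_fin_succ]
      simp only [hle, Fin.cons_zero, Fin.cons_succ]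
      refine ⟨fun ⟨ha, hk, hg⟩ => ⟨⟨ha, fun i => ?_⟩, hk, hg⟩,
        fun ⟨⟨ha, _⟩, hk, hg⟩ => ⟨ha, hk, hg⟩⟩
      have := hk i
      omega

theorem tendsto_subtype_gapTuples (e r : ℕ) [DecidablePred (HasGaps e (r := r))] :
    Tendsto (fun n => (gapTuples e r n).subtype (HasGaps e)) atTop atTop := by
  refine tendsto_atTop_finset_of_monotone (fun m n hmn k hk => ?_) fun k => ⟨∑ i, (k.1 i : ℕ), ?_⟩
  · rw [mem_subtype, mem_gapTuples] at hk ⊢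
    exact ⟨fun i => (hk.1 i).trans hmn, hk.2⟩
  · rw [mem_subtype, mem_gapTuples]
    exact ⟨fun i => single_le_sum_of_canonicallyOrdered (f := fun i => (k.1 i : ℕ)) (mem_univ i),
      k.2⟩

end Gaps

section ChainSum

variable {ι R : Type*}

/-- The truncated nested sum of `w a₁ k₁ ⋯ w a_r k_r` over the tuples `k` with gaps at least `e`
and entries at most `n`, by recursion on the index `(a₁, …, a_r)`. -/
def chainSum [CommSemiring R] (w : ι → ℕ → R) (e : ℕ) : List ι → ℕ → R
  | [], _ => 1
  | a :: l, n => ∑ j ∈ range n, w a (j + 1) * chainSum w e l (j + 1 - e)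

theorem chainSum_cons_succ [CommSemiring R] (w : ι → ℕ → R) (e : ℕ) (a : ι) (l : List ι) (n : ℕ) :
    chainSum w e (a :: l) (n + 1) =
      chainSum w e (a :: l) n + w a (n + 1) * chainSum w e l (n + 1 - e) :=
  sum_range_succ _ _

theorem sum_gapTuples [CommSemiring R] (w : ι → ℕ → R) (e : ℕ) (l : List ι) (n : ℕ) :
    ∑ k ∈ gapTuples e l.length n, ∏ i, w (l.get i) (k i) = chainSum w e l n := by
  induction l generalizing n with
  | nil => simp [gapTuples, chainSum]
  | cons a l ih =>
    simp only [List.length_cons, gapTuples, chainSum, sum_map, sum_sigma, Fin.prod_univ_succ,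
      ← ih, mul_sum]
    rfl

theorem sum_subtype_gapTuples [CommSemiring R] (w : ι → ℕ → R) (e : ℕ) (l : List ι) (n : ℕ)
    [DecidablePred (HasGaps e (r := l.length))] :
    ∑ k ∈ (gapTuples e l.length n).subtype (HasGaps e), ∏ i, w (l.get i) (k.1 i) =
      chainSum w e l n := by
  rw [← sum_gapTuples]
  exact sum_subtype_of_mem (fun k : Fin l.length → ℕ+ => ∏ i, w (l.get i) (k i)) fun _ hk =>
    (mem_gapTuples.1 hk).2

theorem tendsto_chainSum [CommSemiring R] [TopologicalSpace R] {w : ι → ℕ → R} {e : ℕ}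
    {l : List ι} (h : Summable fun k : {k // HasGaps e k} => ∏ i, w (l.get i) (k.1 i)) :
    Tendsto (chainSum w e l) atTop
      (𝓝 (∑' k : {k // HasGaps e k}, ∏ i, w (l.get i) (k.1 i))) := by
  classical
  exact (h.hasSum.comp (tendsto_subtype_gapTuples e l.length)).congr fun n =>
    sum_subtype_gapTuples w e l n

theorem summable_of_chainSum_norm_le [NormedField R] [CompleteSpace R] {w : ι → ℕ → R} {e : ℕ}
    {l : List ι} {C : ℝ} (hC : ∀ n, chainSum (fun a n => ‖w a n‖) e l n ≤ C) :
    Summable fun k : {k // HasGaps e k} => ∏ i, w (l.get i) (k.1 i) := by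
  classical
  refine Summable.of_norm (summable_of_sum_le (c := C) (fun _ => norm_nonneg _) fun u => ?_)
  obtain ⟨n, hn⟩ := ((tendsto_subtype_gapTuples e l.length).eventually_ge_atTop u).exists
  refine (sum_le_sum_of_subset_of_nonneg hn fun _ _ _ => norm_nonneg _).trans ?_
  simp only [norm_prod]
  exact (sum_subtype_gapTuples (fun a n => ‖w a n‖) e l n).trans_le (hC n)

end ChainSum

section Convergence

/-- The factor `ε ^ n / n ^ s` of a summand, for an argument `(s, ε)`. -/
noncomputable def weight (p : ℕ × ℤˣ) (n : ℕ) : ℝ := ((p.2 : ℤ) : ℝ) ^ n / (n : ℝ) ^ p.1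

theorem zetaStarSummable_iff {s : SignedIndex} :
    ZetaStarSummable s ↔
      Summable fun k : {k // HasGaps 0 k} => ∏ i, weight (s.get i) (k.1 i) := by
  rw [← antitone_eq_hasGaps_zero]
  rfl

theorem ZetaStarSummable.zetaSummable {s : SignedIndex} (h : ZetaStarSummable s) :
    ZetaSummable s :=
  h.comp_injective (i := Subtype.map id fun _ => StrictAnti.antitone)
    (Subtype.map_injective _ Function.injective_id)

theorem ZetaSummable.tendsto_chainSum {s : SignedIndex} (h : ZetaSummable s) :
    Tendsto (chainSum weight 1 s) atTop (𝓝 (zeta s)) :=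
  EulerSum.tendsto_chainSum (w := weight) (e := 1) h

theorem ZetaStarSummable.tendsto_chainSum {s : SignedIndex} (h : ZetaStarSummable s) :
    Tendsto (chainSum weight 0 s) atTop (𝓝 (zetaStar s)) := by
  have key := EulerSum.tendsto_chainSum (zetaStarSummable_iff.1 h)
  rw [← antitone_eq_hasGaps_zero] at key
  exact key

theorem norm_weight_succ_le {p : ℕ × ℤˣ} {t : ℕ} (ht : t ≤ p.1) (n : ℕ) :
    ‖weight p (n + 1)‖ ≤ 1 / ((n : ℝ) + 1) ^ t := by
  have hsign : ‖((p.2 : ℤ) : ℝ)‖ = 1 := by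
    rcases Int.units_eq_one_or p.2 with h | h <;> simp [h]
  have hn : (1 : ℝ) ≤ n + 1 := by simp
  rw [weight, norm_div, norm_pow, norm_pow, hsign, one_pow, Real.norm_natCast, Nat.cast_add_one]
  gcongr

theorem sum_range_one_div_sqrt_le (n : ℕ) :
    ∑ j ∈ range n, 1 / √((j : ℝ) + 1) ≤ 2 * √n := by
  induction n with
  | zero => simp
  | succ n ih =>
    have hpos : 0 < √((n : ℝ) + 1) := Real.sqrt_pos.2 (by positivity)
    have hsq : √((n : ℝ) + 1) ^ 2 = √(n : ℝ) ^ 2 + 1 := by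
      rw [Real.sq_sqrt (by positivity), Real.sq_sqrt (by positivity)]
    have hstep : 1 / √((n : ℝ) + 1) ≤ 2 * √((n : ℝ) + 1) - 2 * √n := by
      rw [div_le_iff₀ hpos]
      nlinarith [sq_nonneg (√((n : ℝ) + 1) - √n)]
    rw [sum_range_succ, Nat.cast_add_one]
    linarith

theorem exists_chainSum_norm_weight_le_sqrt {s : SignedIndex} (hs : ∀ p ∈ s, 1 ≤ p.1) :
    ∃ C, 0 ≤ C ∧
      ∀ n : ℕ, chainSum (fun p n => ‖weight p n‖) 0 s (n + 1) ≤ C * √((n : ℝ) + 1) := by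
  induction s with
  | nil => exact ⟨1, zero_le_one, fun n => by simp [chainSum]⟩
  | cons p s ih =>
    obtain ⟨hp, hs⟩ := List.forall_mem_cons.1 hs
    obtain ⟨C, hC0, hC⟩ := ih hs
    refine ⟨2 * C, by positivity, fun n => ?_⟩
    calc chainSum (fun p n => ‖weight p n‖) 0 (p :: s) (n + 1)
        ≤ ∑ j ∈ range (n + 1), 1 / ((j : ℝ) + 1) ^ 1 * (C * √((j : ℝ) + 1)) := by
          refine sum_le_sum fun j _ => ?_
          exact mul_le_mul_of_nonneg (norm_weight_succ_le hp j) (hC j) (norm_nonneg _)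
            (by positivity)
      _ = C * ∑ j ∈ range (n + 1), 1 / √((j : ℝ) + 1) := by
          rw [mul_sum]
          refine sum_congr rfl fun j _ => ?_
          rw [← Real.sqrt_div_self', pow_one]
          ring
      _ ≤ C * (2 * √((n : ℝ) + 1)) := by
          gcongr
          exact_mod_cast sum_range_one_div_sqrt_le (n + 1)
      _ = 2 * C * √((n : ℝ) + 1) := by ring

/-- Indices with positive arguments, the first of which is at least `2`; their series
converge absolutely, whatever the signs. -/
def IsAdmissible (s : SignedIndex) : Prop :=
  (∀ p ∈ s, 1 ≤ p.1) ∧ ∀ p ∈ s.head?, 2 ≤ p.1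

theorem summable_sqrt_div_sq :
    Summable fun j : ℕ => 1 / ((j : ℝ) + 1) ^ 2 * √((j : ℝ) + 1) := by
  have h := (summable_nat_add_iff 1).2
    (Real.summable_one_div_nat_rpow.2 (by norm_num : (1 : ℝ) < 3 / 2))
  refine h.congr fun j => ?_
  have hj : (0 : ℝ) < j + 1 := by positivity
  rw [Nat.cast_add_one, Real.sqrt_eq_rpow, ← Real.rpow_natCast, one_div, one_div,
    ← Real.rpow_neg hj.le, ← Real.rpow_neg hj.le, ← Real.rpow_add hj]
  norm_num

theorem IsAdmissible.zetaStarSummable {s : SignedIndex} (hs : IsAdmissible s) :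
    ZetaStarSummable s := by
  rw [zetaStarSummable_iff]
  cases s with
  | nil => exact summable_of_chainSum_norm_le fun _ => le_rfl
  | cons p s =>
    obtain ⟨C, hC0, hC⟩ := exists_chainSum_norm_weight_le_sqrt (List.forall_mem_cons.1 hs.1).2
    have hbound : ∀ j : ℕ,
        ‖weight p (j + 1)‖ * chainSum (fun p n => ‖weight p n‖) 0 s (j + 1) ≤
          1 / ((j : ℝ) + 1) ^ 2 * √((j : ℝ) + 1) * C := fun j => by
      rw [mul_assoc, mul_comm _ C]
      exact mul_le_mul_of_nonneg (norm_weight_succ_le (hs.2 p rfl) j) (hC j) (norm_nonneg _)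
        (by positivity)
    exact summable_of_chainSum_norm_le fun n => (sum_le_sum fun j _ => hbound j).trans
      ((summable_sqrt_div_sq.mul_right C).sum_le_tsum _ fun _ _ => by positivity)

end Convergence

section Kernel

/-- The quotient `n!² / ((n - k)! (n + k)!)`, read as `0` for `k > n`. -/
noncomputable def kernel (n k : ℕ) : ℝ := n.descFactorial k / (n + 1).ascFactorial k

theorem kernel_zero_right (n : ℕ) : kernel n 0 = 1 := by simp [kernel]

theorem kernel_eq_zero_of_lt {n k : ℕ} (h : n < k) : kernel n k = 0 := by
  simp [kernel, Nat.descFactorial_of_lt h]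

theorem kernel_nonneg (n k : ℕ) : 0 ≤ kernel n k := by
  unfold kernel
  positivity

theorem kernel_le_one (n k : ℕ) : kernel n k ≤ 1 := by
  refine div_le_one_of_le₀ ?_ (by positivity)
  have : n.descFactorial k ≤ (n + 1).ascFactorial k :=
    (n.descFactorial_le_pow k).trans
      ((Nat.pow_le_pow_left n.le_succ k).trans ((n + 1).pow_succ_le_ascFactorial k))
  exact_mod_cast this

theorem kernel_succ_right (n k : ℕ) :
    kernel n (k + 1) = kernel n k * ((n - k) / (n + k + 1)) := by
  rcases le_or_gt k n with h | h
  · rw [kernel, kernel, Nat.descFactorial_succ, Nat.ascFactorial_succ]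
    push_cast [Nat.cast_sub h]
    rw [mul_comm (n - k : ℝ), add_right_comm (n : ℝ) 1 k, mul_comm (n + k + 1 : ℝ),
      mul_div_mul_comm]
  · rw [kernel_eq_zero_of_lt h, kernel_eq_zero_of_lt (h.trans k.lt_succ_self), zero_mul]

theorem kernel_succ_right_mul (n k : ℕ) :
    kernel n (k + 1) * (n + k + 1) = kernel n k * (n - k) := by
  rw [kernel_succ_right, mul_assoc, div_mul_cancel₀ _ (by positivity)]

theorem tendsto_kernel (k : ℕ) : Tendsto (fun n => kernel n k) atTop (𝓝 1) := by
  induction k with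
  | zero => simp [kernel_zero_right]
  | succ k ih =>
    have hratio : Tendsto (fun n : ℕ => ((n : ℝ) - k) / (n + k + 1)) atTop (𝓝 1) := by
      have h := tendsto_add_mul_div_add_mul_atTop_nhds (-k : ℝ) (k + 1) 1 one_ne_zero
      rw [div_one] at h
      exact h.congr fun n => by ring
    simpa only [kernel_succ_right, mul_one] using ih.mul hratio

theorem kernel_mul_succ_sq (n k : ℕ) :
    kernel n k * ((n : ℝ) + 1) ^ 2 = kernel (n + 1) k * (((n : ℝ) + 1) ^ 2 - k ^ 2) := by
  induction k with
  | zero => simp [kernel_zero_right]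
  | succ k ih =>
    have hn := kernel_succ_right_mul n k
    have hsucc := kernel_succ_right_mul (n + 1) k
    push_cast at hsucc ⊢
    apply mul_right_cancel₀ (by positivity : (n : ℝ) + k + 1 ≠ 0)
    linear_combination ((n : ℝ) + 1) ^ 2 * hn + (n - k) * ih - (n - k) * (n + k + 1) * hsucc

end Kernel

section KernelSum

/-- The average `p_0 + ∑ 1 ≤ k ≤ n, kernel n k * (p_k - p_{k-1})` of a sequence `p`; it has the
same limit as `p`. -/
noncomputable def kernelSum (p : ℕ → ℝ) (n : ℕ) : ℝ :=
  p 0 + ∑ k ∈ range n, kernel n (k + 1) * (p (k + 1) - p k)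

/-- The companion `∑ 1 ≤ k ≤ n, (-1)^k * kernel n k * (p_k + p_{k-1})` of `kernelSum`, through
which the latter is computed recursively. -/
noncomputable def altKernelSum (p : ℕ → ℝ) (n : ℕ) : ℝ :=
  ∑ k ∈ range n, (-1) ^ (k + 1) * kernel n (k + 1) * (p (k + 1) + p k)

theorem tendsto_kernelSum {p : ℕ → ℝ} {L : ℝ} (hp : Summable fun k => p (k + 1) - p k)
    (hL : Tendsto p atTop (𝓝 L)) : Tendsto (kernelSum p) atTop (𝓝 L) := by
  have htotal : p 0 + ∑' k, (p (k + 1) - p k) = L := by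
    refine tendsto_nhds_unique (hp.hasSum.tendsto_sum_nat.const_add (p 0)) ?_
    simpa only [sum_range_sub, add_sub_cancel] using hL
  have htsum (n : ℕ) : kernelSum p n = p 0 + ∑' k, kernel n (k + 1) * (p (k + 1) - p k) := by
    rw [kernelSum, tsum_eq_sum]
    intro k hk
    rw [kernel_eq_zero_of_lt (by simpa [Nat.lt_succ_iff] using hk), zero_mul]
  rw [← htotal, funext htsum]
  refine (tendsto_tsum_of_dominated_convergence hp.norm (fun k => ?_)
    (.of_forall fun n k => ?_)).const_add (p 0)
  · simpa only [one_mul] using (tendsto_kernel (k + 1)).mul_const (p (k + 1) - p k)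
  · rw [norm_mul, Real.norm_of_nonneg (kernel_nonneg _ _)]
    exact mul_le_of_le_one_left (norm_nonneg _) (kernel_le_one _ _)

theorem sum_range_succ_kernel_mul (n : ℕ) (f : ℕ → ℝ) :
    ∑ k ∈ range (n + 1), kernel n (k + 1) * f k = ∑ k ∈ range n, kernel n (k + 1) * f k := by
  rw [sum_range_succ, kernel_eq_zero_of_lt n.lt_succ_self, zero_mul, add_zero]

theorem kernelSum_succ (p : ℕ → ℝ) (n : ℕ) :
    kernelSum p (n + 1) = kernelSum p n +
      (∑ k ∈ range (n + 1), kernel (n + 1) (k + 1) * (((k : ℝ) + 1) ^ 2 * (p (k + 1) - p k))) /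
        ((n : ℝ) + 1) ^ 2 := by
  rw [kernelSum, kernelSum, ← sum_range_succ_kernel_mul n, add_assoc, sum_div, ← sum_add_distrib]
  congr 1
  refine sum_congr rfl fun k _ => ?_
  have hkernel := kernel_mul_succ_sq n (k + 1)
  push_cast at hkernel
  field_simp
  linear_combination -(p (k + 1) - p k) * hkernel

theorem kernelSum_succ_eq_sum_add (p : ℕ → ℝ) (n : ℕ) :
    kernelSum p (n + 1) =
      (∑ k ∈ range (n + 1), kernel (n + 1) (k + 1) * (((k : ℝ) + 1) * (p (k + 1) + p k))) /
        ((n : ℝ) + 1) := by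
  -- `boundary` is read off from the coefficients of `p (k + 1)` in `htelescope`; those of `p k`
  -- then agree because of `kernel_succ_right_mul`.
  let boundary (k : ℕ) : ℝ := kernel (n + 1) k * (1 - k / (n + 1)) * p k
  have htelescope (k : ℕ) : kernel (n + 1) (k + 1) * (p (k + 1) - p k) =
      kernel (n + 1) (k + 1) * (((k : ℝ) + 1) * (p (k + 1) + p k)) / ((n : ℝ) + 1) +
        (boundary (k + 1) - boundary k) := by
    have hkernel := kernel_succ_right_mul (n + 1) k
    simp only [boundary]
    push_cast at hkernel ⊢
    field_simp
    linear_combination -p k * hkernel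
  have hzero : boundary 0 = p 0 := by simp [boundary, kernel_zero_right]
  have hlast : boundary (n + 1) = 0 := by
    simp only [boundary]
    push_cast
    rw [div_self (by positivity), sub_self, mul_zero, zero_mul]
  rw [kernelSum, sum_congr rfl fun k _ => htelescope k, sum_add_distrib, sum_range_sub, hzero,
    hlast, sum_div]
  ring

theorem succ_mul_altKernelSum_succ (p : ℕ → ℝ) (n : ℕ) :
    ((n : ℝ) + 1) * altKernelSum p (n + 1) = n * altKernelSum p n +
      (∑ k ∈ range (n + 1), (-1) ^ (k + 1) * kernel (n + 1) (k + 1) *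
        (((k : ℝ) + 1) ^ 3 * (p (k + 1) - p k))) / ((n : ℝ) + 1) ^ 2 - p 0 := by
  let boundary (k : ℕ) : ℝ :=
    (-1) ^ k * kernel (n + 1) k * (n + 1 - k) * ((k : ℝ) ^ 2 + k + n + 1) / ((n : ℝ) + 1) ^ 2 * p k
  have htelescope (k : ℕ) :
      ((n : ℝ) + 1) * ((-1) ^ (k + 1) * kernel (n + 1) (k + 1) * (p (k + 1) + p k)) =
        n * ((-1) ^ (k + 1) * kernel n (k + 1) * (p (k + 1) + p k)) +
        (-1) ^ (k + 1) * kernel (n + 1) (k + 1) * (((k : ℝ) + 1) ^ 3 * (p (k + 1) - p k)) /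
          ((n : ℝ) + 1) ^ 2 + (boundary (k + 1) - boundary k) := by
    have hsucc := kernel_succ_right_mul (n + 1) k
    have hkernel := kernel_mul_succ_sq n (k + 1)
    simp only [boundary, pow_succ (-1 : ℝ)]
    push_cast at hsucc hkernel ⊢
    field_simp
    linear_combination n * (p (k + 1) + p k) * hkernel -
      p k * ((k : ℝ) ^ 2 + k + n + 1) * hsucc
  have hzero : boundary 0 = p 0 := by
    simp only [boundary, kernel_zero_right]
    push_cast
    field_simp
    ring
  have hlast : boundary (n + 1) = 0 := by simp [boundary]
  have hextend : altKernelSum p n =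
      ∑ k ∈ range (n + 1), (-1) ^ (k + 1) * kernel n (k + 1) * (p (k + 1) + p k) := by
    simp only [altKernelSum, mul_assoc, mul_left_comm _ (kernel _ _), sum_range_succ_kernel_mul]
  rw [hextend, altKernelSum, mul_sum, sum_congr rfl fun k _ => htelescope k, sum_add_distrib,
    sum_add_distrib, sum_range_sub, hzero, hlast, sum_div, mul_sum]
  ring

/-- The recursion relating the coefficients `p = c_m` and `q = c_{m+1}` of the partial products of
`(1 + t_j) / (1 - t_j)`, `t_j = (-1)^j z / j²`. -/
def IsNextCoeff (p q : ℕ → ℝ) : Prop :=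
  ∀ k : ℕ, q (k + 1) - q k = (-1) ^ (k + 1) / ((k : ℝ) + 1) ^ 2 * (p (k + 1) + p k)

theorem isNextCoeff_zero_one : IsNextCoeff 0 1 := by simp [IsNextCoeff]

theorem IsNextCoeff.kernelSum_eq {p q : ℕ → ℝ} (h : IsNextCoeff p q) (n : ℕ) :
    kernelSum q n = q 0 + ∑ j ∈ range n, altKernelSum p (j + 1) / ((j : ℝ) + 1) ^ 2 := by
  induction n with
  | zero => simp [kernelSum]
  | succ n ih =>
    have hnext : ∑ k ∈ range (n + 1),
        kernel (n + 1) (k + 1) * (((k : ℝ) + 1) ^ 2 * (q (k + 1) - q k)) =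
          altKernelSum p (n + 1) := by
      refine sum_congr rfl fun k _ => ?_
      rw [h k]
      field_simp
    rw [kernelSum_succ, hnext, ih, sum_range_succ, add_assoc]

theorem IsNextCoeff.mul_altKernelSum_eq {p q : ℕ → ℝ} (h : IsNextCoeff p q) (n : ℕ) :
    n * altKernelSum q n = ∑ j ∈ range n, (kernelSum p (j + 1) / ((j : ℝ) + 1) - q 0) := by
  induction n with
  | zero => simp
  | succ n ih =>
    have hnext : ∑ k ∈ range (n + 1), (-1) ^ (k + 1) * kernel (n + 1) (k + 1) *
        (((k : ℝ) + 1) ^ 3 * (q (k + 1) - q k)) = kernelSum p (n + 1) * ((n : ℝ) + 1) := by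
      rw [kernelSum_succ_eq_sum_add, div_mul_cancel₀ _ (by positivity)]
      refine sum_congr rfl fun k _ => ?_
      have hsign : (-1 : ℝ) ^ (k + 1) * (-1) ^ (k + 1) = 1 := pow_mul_pow_eq_one _ (by norm_num)
      rw [h k]
      field_simp
      linear_combination kernel (n + 1) (k + 1) * (p (k + 1) + p k) * hsign
    rw [Nat.cast_add_one, succ_mul_altKernelSum_succ, hnext, ih, sum_range_succ]
    have hcancel : kernelSum p (n + 1) * ((n : ℝ) + 1) / ((n : ℝ) + 1) ^ 2 =
        kernelSum p (n + 1) / ((n : ℝ) + 1) := by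
      field_simp
    rw [hcancel, add_sub_assoc]

theorem kernelSum_eq_chainSum_three_one {o p q : ℕ → ℝ} (hop : IsNextCoeff o p)
    (hpq : IsNextCoeff p q) (hp : p 0 = 0) (hq : q 0 = 0) {ε : ℝ} {s : SignedIndex}
    (ho : ∀ n, kernelSum o n = ε * chainSum weight 0 s n) (n : ℕ) :
    kernelSum q n = ε * chainSum weight 0 (plain 3 :: plain 1 :: s) n := by
  have halt (n : ℕ) : n * altKernelSum p n = ε * chainSum weight 0 (plain 1 :: s) n := by
    rw [hop.mul_altKernelSum_eq, hp, chainSum, mul_sum]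
    refine sum_congr rfl fun j _ => ?_
    simp only [ho, weight, plain, Units.val_one, Int.cast_one, one_pow, pow_one, tsub_zero]
    push_cast
    ring
  rw [hpq.kernelSum_eq, hq, zero_add, chainSum, mul_sum]
  refine sum_congr rfl fun j _ => ?_
  have hj := halt (j + 1)
  simp only [weight, plain, Units.val_one, Int.cast_one, one_pow, tsub_zero]
  push_cast at hj ⊢
  field_simp
  exact (mul_comm _ _).trans hj

theorem kernelSum_eq_neg_chainSum_two {q : ℕ → ℝ} (h : IsNextCoeff 1 q) (hq : q 0 = 0) (n : ℕ) :
    kernelSum q n = -1 * chainSum weight 0 [plain 2] n := by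
  have halt (j : ℕ) : altKernelSum 1 (j + 1) = -1 := by
    have hj := isNextCoeff_zero_one.mul_altKernelSum_eq (j + 1)
    simp only [kernelSum, Pi.zero_apply, Pi.one_apply, sub_self, mul_zero, sum_const_zero,
      add_zero, zero_div, zero_sub, sum_const, card_range, nsmul_eq_mul] at hj
    exact mul_left_cancel₀ (Nat.cast_ne_zero.2 j.succ_ne_zero) hj
  rw [h.kernelSum_eq, hq, zero_add, chainSum, mul_sum]
  refine sum_congr rfl fun j _ => ?_
  simp [halt, weight, plain, chainSum, neg_div]

end KernelSum

section BarTwo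

open PowerSeries

/-- The generating series of the truncated nested sums of `(a, …, a)`: for `e = 1` it is
`∏ j ≤ n, (1 + w a j * X)`, and for `e = 0` it is `∏ j ≤ n, (1 - w a j * X)⁻¹`. -/
noncomputable def chainSeries {ι R : Type*} [CommSemiring R] (w : ι → ℕ → R) (e : ℕ) (a : ι)
    (n : ℕ) : R⟦X⟧ :=
  PowerSeries.mk fun i => chainSum w e (List.replicate i a) n

section

variable {ι R : Type*}

theorem chainSeries_zero_right [CommSemiring R] (w : ι → ℕ → R) (e : ℕ) (a : ι) :
    chainSeries w e a 0 = 1 := by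
  ext i
  cases i <;> simp [chainSeries, chainSum, List.replicate_succ, coeff_one]

theorem chainSeries_one_succ [CommSemiring R] (w : ι → ℕ → R) (a : ι) (n : ℕ) :
    chainSeries w 1 a (n + 1) = (1 + X * C (w a (n + 1))) * chainSeries w 1 a n := by
  rw [add_mul, one_mul, mul_assoc]
  ext (_ | i)
  · simp [chainSeries, chainSum]
  · rw [map_add, coeff_succ_X_mul, coeff_C_mul]
    simp only [chainSeries, coeff_mk, List.replicate_succ, chainSum_cons_succ,
      add_tsub_cancel_right]

theorem chainSeries_zero_succ [CommRing R] (w : ι → ℕ → R) (a : ι) (n : ℕ) :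
    (1 - X * C (w a (n + 1))) * chainSeries w 0 a (n + 1) = chainSeries w 0 a n := by
  rw [sub_mul, one_mul, mul_assoc, sub_eq_iff_eq_add]
  ext (_ | i)
  · simp [chainSeries, chainSum]
  · rw [map_add, coeff_succ_X_mul, coeff_C_mul]
    simp only [chainSeries, coeff_mk, List.replicate_succ, chainSum_cons_succ, tsub_zero]

theorem chainSeries_mul_succ_sub [CommRing R] (w : ι → ℕ → R) (a : ι) (n : ℕ) :
    chainSeries w 1 a (n + 1) * chainSeries w 0 a (n + 1) -
        chainSeries w 1 a n * chainSeries w 0 a n =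
      X * (C (w a (n + 1)) * (chainSeries w 1 a (n + 1) * chainSeries w 0 a (n + 1) +
        chainSeries w 1 a n * chainSeries w 0 a n)) := by
  rw [← chainSeries_zero_succ w a n, chainSeries_one_succ w a n]
  ring

end

/-- The coefficient `c_m(n)` of `z ^ m` in the product over `j ≤ n` of `(1 + t_j) / (1 - t_j)`,
where `t_j = (-1)^j z / j²`. -/
noncomputable def barTwoCoeff (m n : ℕ) : ℝ :=
  coeff m (chainSeries weight 1 (bar 2) n * chainSeries weight 0 (bar 2) n)

theorem barTwoCoeff_eq_sum (m n : ℕ) :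
    barTwoCoeff m n = ∑ k ∈ range (m + 1),
      chainSum weight 1 (List.replicate k (bar 2)) n *
        chainSum weight 0 (List.replicate (m - k) (bar 2)) n := by
  rw [barTwoCoeff, coeff_mul, Nat.sum_antidiagonal_eq_sum_range_succ_mk]
  simp only [chainSeries, coeff_mk]

theorem barTwoCoeff_zero_left : barTwoCoeff 0 = 1 := by
  ext n
  simp [barTwoCoeff_eq_sum, chainSum]

theorem barTwoCoeff_succ_zero (m : ℕ) : barTwoCoeff (m + 1) 0 = 0 := by
  simp [barTwoCoeff, chainSeries_zero_right, coeff_one]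

theorem isNextCoeff_barTwoCoeff (m : ℕ) : IsNextCoeff (barTwoCoeff m) (barTwoCoeff (m + 1)) := by
  intro k
  have h := congrArg (coeff (m + 1)) (chainSeries_mul_succ_sub weight (bar 2) k)
  rw [map_sub, coeff_succ_X_mul, coeff_C_mul, map_add] at h
  have hweight : weight (bar 2) (k + 1) = (-1) ^ (k + 1) / ((k : ℝ) + 1) ^ 2 := by
    simp [weight, bar]
  rwa [hweight] at h

theorem kernelSum_barTwoCoeff {m : ℕ} {ε : ℝ} {s : SignedIndex}
    (h : ∀ n, kernelSum (barTwoCoeff m) n = ε * chainSum weight 0 s n) (d n : ℕ) :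
    kernelSum (barTwoCoeff (2 * d + m)) n =
      ε * chainSum weight 0 (rep [plain 3, plain 1] d ++ s) n := by
  induction d generalizing n with
  | zero => simpa [rep] using h n
  | succ d ih =>
    rw [show 2 * (d + 1) + m = 2 * d + m + 1 + 1 by ring]
    exact kernelSum_eq_chainSum_three_one (isNextCoeff_barTwoCoeff _) (isNextCoeff_barTwoCoeff _)
      (barTwoCoeff_succ_zero _) (barTwoCoeff_succ_zero _) ih n

theorem rep_singleton (a : ℕ × ℤˣ) (d : ℕ) : rep [a] d = List.replicate d a := by
  simp [rep]

theorem isAdmissible_rep_bar_two (k : ℕ) : IsAdmissible (rep [bar 2] k) := by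
  have hbar : ∀ p ∈ rep [bar 2] k, p.1 = 2 := fun p hp => by
    rw [rep_singleton] at hp
    rw [List.eq_of_mem_replicate hp, bar]
  exact ⟨fun p hp => by simp [hbar p hp],
    fun p hp => (hbar p (List.mem_of_mem_head? hp)).ge⟩

theorem isAdmissible_nil : IsAdmissible [] := by simp [IsAdmissible]

theorem isAdmissible_two : IsAdmissible [plain 2] := by simp [IsAdmissible, plain]

theorem isAdmissible_rep_three_one_append (d : ℕ) {s : SignedIndex} (hs : IsAdmissible s) :
    IsAdmissible (rep [plain 3, plain 1] d ++ s) := by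
  induction d with
  | zero => exact hs
  | succ d ih =>
    refine ⟨List.forall_mem_cons.2 ⟨?_, List.forall_mem_cons.2 ⟨?_, ih.1⟩⟩, ?_⟩ <;>
      simp [rep, plain]

theorem tendsto_barTwoCoeff (m : ℕ) :
    Tendsto (barTwoCoeff m) atTop
      (𝓝 (∑ k ∈ range (m + 1), zeta (rep [bar 2] k) * zetaStar (rep [bar 2] (m - k)))) := by
  simp only [funext (barTwoCoeff_eq_sum m), ← rep_singleton]
  refine tendsto_finsetSum _ fun k _ => ?_
  exact (isAdmissible_rep_bar_two k).zetaStarSummable.zetaSummable.tendsto_chainSum.mul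
    (isAdmissible_rep_bar_two (m - k)).zetaStarSummable.tendsto_chainSum

theorem summable_barTwoCoeff_sub (m : ℕ) :
    Summable fun n => barTwoCoeff m (n + 1) - barTwoCoeff m n := by
  cases m with
  | zero => simp [barTwoCoeff_zero_left]
  | succ m =>
    obtain ⟨B, hB⟩ := (tendsto_barTwoCoeff m).norm.bddAbove_range
    have hbound (k : ℕ) : ‖barTwoCoeff m k‖ ≤ B := hB (Set.mem_range_self k)
    have hsq : Summable fun k : ℕ => 1 / ((k : ℝ) + 1) ^ 2 := by
      exact_mod_cast (summable_nat_add_iff 1).2 (Real.summable_one_div_nat_pow.2 one_lt_two)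
    refine Summable.of_norm_bounded (hsq.mul_right (B + B)) fun k => ?_
    rw [isNextCoeff_barTwoCoeff m k, norm_mul, norm_div, norm_pow, norm_neg, norm_one, one_pow,
      Real.norm_of_nonneg (by positivity)]
    gcongr
    exact norm_add_le_of_le (hbound _) (hbound _)

theorem mul_zetaStar_rep_three_one_append {m : ℕ} {ε : ℝ} {s : SignedIndex} (hs : IsAdmissible s)
    (h : ∀ n, kernelSum (barTwoCoeff m) n = ε * chainSum weight 0 s n) (d : ℕ) :
    ε * zetaStar (rep [plain 3, plain 1] d ++ s) =
      ∑ k ∈ range (2 * d + m + 1),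
        zeta (rep [bar 2] k) * zetaStar (rep [bar 2] (2 * d + m - k)) := by
  have hstar := (isAdmissible_rep_three_one_append d hs).zetaStarSummable.tendsto_chainSum
  refine tendsto_nhds_unique ((hstar.const_mul ε).congr fun n => ?_)
    (tendsto_kernelSum (summable_barTwoCoeff_sub _) (tendsto_barTwoCoeff _))
  exact (kernelSum_barTwoCoeff h d n).symm

theorem zetaStar_rep_three_one (d : ℕ) :
    zetaStar (rep [plain 3, plain 1] d) =
      ∑ k ∈ range (2 * d + 1), zeta (rep [bar 2] k) * zetaStar (rep [bar 2] (2 * d - k)) := by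
  have hbase (n : ℕ) : kernelSum (barTwoCoeff 0) n = 1 * chainSum weight 0 [] n := by
    simp [barTwoCoeff_zero_left, kernelSum, chainSum]
  have h := mul_zetaStar_rep_three_one_append isAdmissible_nil hbase d
  rwa [one_mul, List.append_nil] at h

theorem zetaStar_rep_three_one_append_two (d : ℕ) :
    zetaStar (rep [plain 3, plain 1] d ++ [plain 2]) =
      -∑ k ∈ range (2 * d + 2), zeta (rep [bar 2] k) * zetaStar (rep [bar 2] (2 * d + 1 - k)) := by
  have hbase := kernelSum_eq_neg_chainSum_two (barTwoCoeff_zero_left ▸ isNextCoeff_barTwoCoeff 0)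
    (barTwoCoeff_succ_zero 0)
  have h := mul_zetaStar_rep_three_one_append isAdmissible_two hbase d
  rwa [neg_one_mul, neg_eq_iff_eq_neg] at h

end BarTwo

end EulerSum

theorem mainTheorem9 :
    -- all the series involved converge absolutely
    (∀ k : ℕ, EulerSum.ZetaSummable (EulerSum.rep [EulerSum.bar 2] k) ∧
      EulerSum.ZetaStarSummable (EulerSum.rep [EulerSum.bar 2] k)) ∧
    ∀ d : ℕ,
      (EulerSum.ZetaStarSummable (EulerSum.rep [EulerSum.plain 3, EulerSum.plain 1] d) ∧
        EulerSum.zetaStar (EulerSum.rep [EulerSum.plain 3, EulerSum.plain 1] d) =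
          ∑ k ∈ Finset.range (2 * d + 1),
            EulerSum.zeta (EulerSum.rep [EulerSum.bar 2] k) *
              EulerSum.zetaStar (EulerSum.rep [EulerSum.bar 2] (2 * d - k))) ∧
      (EulerSum.ZetaStarSummable
          (EulerSum.rep [EulerSum.plain 3, EulerSum.plain 1] d ++ [EulerSum.plain 2]) ∧
        EulerSum.zetaStar
            (EulerSum.rep [EulerSum.plain 3, EulerSum.plain 1] d ++ [EulerSum.plain 2]) =
          -∑ k ∈ Finset.range (2 * d + 2),
            EulerSum.zeta (EulerSum.rep [EulerSum.bar 2] k) *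
              EulerSum.zetaStar (EulerSum.rep [EulerSum.bar 2] (2 * d + 1 - k))) := by
  refine ⟨fun k => ?_, fun d => ⟨⟨?_, EulerSum.zetaStar_rep_three_one d⟩,
    ?_, EulerSum.zetaStar_rep_three_one_append_two d⟩⟩
  · have hstar := (EulerSum.isAdmissible_rep_bar_two k).zetaStarSummable
    exact ⟨hstar.zetaSummable, hstar⟩
  · rw [← List.append_nil (EulerSum.rep _ d)]
    exact (EulerSum.isAdmissible_rep_three_one_append d EulerSum.isAdmissible_nil).zetaStarSummable
  · exact (EulerSum.isAdmissible_rep_three_one_append d EulerSum.isAdmissible_two).zetaStarSummable
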